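/- Let $N\ge 1$, $q\ge 0$. For $i=1,\dots,N$ consider agents $$\dot x_i=A_ix_i+B_iu_i,\qquad y_i=C_ix_i,\qquad x_i\in\mathbb R^{n_i},\ u_i\in\mathbb R^{p_i},\ y_i\in\mathbb R^q,$$ with constant real matrices $A_i,B_i,C_i$ and local cost functions $f_i:\mathbb R^q\to\mathbb R$, and the problem $$\min\ \sum_{i=1}^N f_i(y_i)\quad\text{s.t.}\quad y_1=\dots=y_N.\tag{P}$$ Assume: 1. The communication graph is undirected and connected, with symmetric weights $a_{ij}=a_{ji}$, $a_{ij}>0$ if $\{i,j\}$ is an edge and $a_{ij}=0$ otherwise. Let $L=\mathrm{diag}\big(\sum_j a_{ji}\big)_i-(a_{ij})$ be its Laplacian and $\lambda_N$ the largest eigenvalue of $L$. 2. Each $f_i$ is differentiable and $\|\nabla f_i(x)-\nabla f_i(y)\|\le w_i\|x-y\|$ for all $x,y\in\mathbb R^q$, with $w_i>0$. Let $\overline w=\max_i w_i$. 3. $(x-y)^\top(\nabla f_i(x)-\nabla f_i(y))\ge m_i\|x-y\|^2$ for all $x,y\in\mathbb R^q$, with $m_i>0$. Let $\underline m=\min_i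 m_i$. 4. Each pair $(A_i,B_i)$ is controllable, and $\mathrm{rank}(C_iB_i)=q$. Let $K_{\alpha_i},K_{\beta_i}$ be any solutions of $C_iB_iK_{\alpha_i}=C_iA_i$ and $C_iB_iK_{\beta_i}=I_q$. Let $\xi>\frac{4\overline w^2+2\lambda_N^2+1}{8\underline m}$, $\epsilon=\frac{1}{2\sqrt{2(\xi^2+(\xi-1)^2)}}$ and $$\tau_0=\frac{1}{\overline w+1}\ln\left(1+\frac{(\overline w+1)\epsilon}{\overline w+1+\sqrt2\lambda_N+\sqrt2\lambda_N\epsilon}\right).$$ Then (P) has a unique solution $y_1=\dots=y_N=y^*$, and there is a rate $c>0$ such that the following holds for every $\Delta\in(0,\tau_0]$. Let all agents communicate at the instants $t_0=0$, $t_{k+1}=t_k+\Delta$, put $\hat y_i(t)=y_i(t_k)$ for $t\in[t_k,t_{k+1})$, and apply the protocol $$u_i=-K_{\alpha_i}x_i+K_{\beta_i}\Big(-\nabla f_i(y_i)-\sum_{j=1}^N a_{ij}(\hat y_i-\hat y_j)-\eta_i\Big),\qquad \dot\eta_i=\sum_{j=1}^N a_{ij}(\hat y_i-\hat y_j),\quad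 \eta_i(0)=0.$$ Then for every solution of the closed-loop system on $[0,\infty)$ (with any initial states $x_i(0)$; continuous $x_i,\eta_i$, with the differential equations holding for right derivatives) there is a constant $M$ such that $\|y_i(t)-y^*\|\le M e^{-ct}$ for all $t\ge 0$ and all $i$; that is, every output converges to $y^*$ exponentially. -/

import Mathlib

noncomputable section

namespace OptimalOutput

/-- A weighted undirected communication graph on `N` nodes: `a i j` is the weight of the edge
between `i` and `j`, positive exactly on the edges. -/
structure CommGraph (N : ℕ) where
  graph : SimpleGraph (Fin N)
  a : Matrix (Fin N) (Fin N) ℝ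
  symm : ∀ i j, a i j = a j i
  pos_of_adj : ∀ i j, graph.Adj i j → 0 < a i j
  zero_of_not_adj : ∀ i j, ¬ graph.Adj i j → a i j = 0

/-- The Laplacian `D^out - A`, with `D^out` the diagonal matrix of the `d_i = ∑ j, a j i`. -/
def CommGraph.laplacian {N : ℕ} (G : CommGraph N) : Matrix (Fin N) (Fin N) ℝ :=
  Matrix.diagonal (fun i => ∑ j, G.a j i) - G.a

/-- The largest eigenvalue `λ_N` of the (real symmetric) Laplacian. -/
def CommGraph.lambdaMax {N : ℕ} (G : CommGraph N) : ℝ :=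
  sSup (spectrum ℝ G.laplacian)

/-- The data of `N` heterogeneous linear agents `ẋ_i = A_i x_i + B_i u_i`, `y_i = C_i x_i`
with outputs in `ℝ^q`, and of their local cost functions `f_i`. -/
structure MultiAgent (N q : ℕ) where
  n : Fin N → ℕ
  p : Fin N → ℕ
  A : ∀ i, Matrix (Fin (n i)) (Fin (n i)) ℝ
  B : ∀ i, Matrix (Fin (n i)) (Fin (p i)) ℝ
  C : ∀ i, Matrix (Fin q) (Fin (n i)) ℝ
  f : Fin N → EuclideanSpace ℝ (Fin q) → ℝ

/-- The controllability matrix `(B, AB, …, A^{n-1}B)`; its columns are indexed by pairs `(k, c)`,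
for column `c` of the block `A^k B`. -/
def controllabilityMatrix {n p : ℕ} (A : Matrix (Fin n) (Fin n) ℝ)
    (B : Matrix (Fin n) (Fin p) ℝ) : Matrix (Fin n) (Fin n × Fin p) ℝ :=
  Matrix.of fun r kc => (A ^ (kc.1 : ℕ) * B) r kc.2

/-- Controllability of the pair `(A, B)` (Kalman). -/
def Controllable {n p : ℕ} (A : Matrix (Fin n) (Fin n) ℝ)
    (B : Matrix (Fin n) (Fin p) ℝ) : Prop :=
  (controllabilityMatrix A B).rank = n

/-- Each `f_i` is differentiable with `w_i`-Lipschitz gradient, `w_i > 0`. -/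
structure MultiAgent.SmoothCosts {N q : ℕ} (S : MultiAgent N q) (w : Fin N → ℝ) : Prop where
  pos : ∀ i, 0 < w i
  differentiable : ∀ i, Differentiable ℝ (S.f i)
  lipschitz : ∀ i x y, ‖gradient (S.f i) x - gradient (S.f i) y‖ ≤ w i * ‖x - y‖

/-- Each `f_i` is `m_i`-strongly convex, `m_i > 0`. -/
structure MultiAgent.StronglyConvexCosts {N q : ℕ} (S : MultiAgent N q) (m : Fin N → ℝ) :
    Prop where
  pos : ∀ i, 0 < m i
  strong : ∀ i x y,
    m i * ‖x - y‖ ^ 2 ≤ inner ℝ (x - y) (gradient (S.f i) x - gradient (S.f i) y)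

/-- Each `(A_i, B_i)` is controllable and `rank (C_i B_i) = q`. -/
structure MultiAgent.RankCondition {N q : ℕ} (S : MultiAgent N q) : Prop where
  controllable : ∀ i, Controllable (S.A i) (S.B i)
  rank_eq : ∀ i, (S.C i * S.B i).rank = q

/-- `z` is the common value of a solution of `min ∑ f_i(y_i)` subject to `y_1 = ⋯ = y_N`. -/
def MultiAgent.IsOptimal {N q : ℕ} (S : MultiAgent N q) (z : EuclideanSpace ℝ (Fin q)) : Prop :=
  IsMinOn (fun y : Fin N → EuclideanSpace ℝ (Fin q) => ∑ i, S.f i (y i))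
    {y | ∀ i j, y i = y j} (fun _ => z)

/-- The signals `x, u, y, yhat, η` form, on `[0, ∞)`, a trajectory of the agents under the
sampled-output protocol with feedback matrices `Kα i`, `Kβ i` and with the communication instants
`tk i 0, tk i 1, …` of agent `i`.
Because `yhat` jumps at communication instants, the states are continuous and the differential
equations hold for the right derivative (hence for the derivative between instants). -/
structure MultiAgent.IsTrajectory {N q : ℕ} (S : MultiAgent N q) (G : CommGraph N)
    (Kα : ∀ i, Matrix (Fin (S.p i)) (Fin (S.n i)) ℝ)
    (Kβ : ∀ i, Matrix (Fin (S.p i)) (Fin q) ℝ)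
    (tk : Fin N → ℕ → ℝ)
    (x : ∀ i, ℝ → EuclideanSpace ℝ (Fin (S.n i)))
    (u : ∀ i, ℝ → EuclideanSpace ℝ (Fin (S.p i)))
    (y yhat η : Fin N → ℝ → EuclideanSpace ℝ (Fin q)) : Prop where
  output : ∀ i, ∀ t, 0 ≤ t → y i t = Matrix.toEuclideanLin (S.C i) (x i t)
  hold : ∀ i k, ∀ t ∈ Set.Ico (tk i k) (tk i (k + 1)), yhat i t = y i (tk i k)
  input : ∀ i, ∀ t, 0 ≤ t →
    u i t = - Matrix.toEuclideanLin (Kα i) (x i t)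
      + Matrix.toEuclideanLin (Kβ i)
          (- gradient (S.f i) (y i t) - ∑ j, G.a i j • (yhat i t - yhat j t) - η i t)
  state_continuous : ∀ i, ContinuousOn (x i) (Set.Ici 0)
  state_deriv : ∀ i, ∀ t, 0 ≤ t →
    HasDerivWithinAt (x i)
      (Matrix.toEuclideanLin (S.A i) (x i t) + Matrix.toEuclideanLin (S.B i) (u i t))
      (Set.Ici t) t
  integral_zero : ∀ i, η i 0 = 0
  integral_continuous : ∀ i, ContinuousOn (η i) (Set.Ici 0)
  integral_deriv : ∀ i, ∀ t, 0 ≤ t →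
    HasDerivWithinAt (η i) (∑ j, G.a i j • (yhat i t - yhat j t)) (Set.Ici t) t

/-- `ε = 1 / (2 √(2 (ξ² + (ξ - 1)²)))`. -/
def epsilon (ξ : ℝ) : ℝ := 1 / (2 * √(2 * (ξ ^ 2 + (ξ - 1) ^ 2)))

/-- The bound `τ_0` on the communication period, as a function of `w̄`, `λ_N` and `ξ`. -/
def tau0 (wbar lam ξ : ℝ) : ℝ :=
  1 / (wbar + 1) *
    Real.log (1 + (wbar + 1) * epsilon ξ / (wbar + 1 + √2 * lam + √2 * lam * epsilon ξ))

end OptimalOutput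

end

/-!
The feedback linearizes the outputs, so that `z = y - y*` and `ζ = η + ∇f(y*)` (stacked over the
agents) satisfy `ż = -H z - L ẑ - ζ` and `ζ̇ = L ẑ` with `H` strongly monotone at the origin and `L`
the Laplacian. As `∑ ∇fᵢ(y*) = 0`, `ζ` stays orthogonal to `ker L`. Grönwall's inequality run
*backwards* from `t` to the last sampling instant bounds the sampling error `‖ẑ - z‖` by
`ε ‖(z, ζ)‖` at the *current* time as long as the gap is at most `τ₀`. With `P` an inverse of `L`
on `(ker L)ᗮ`, the function `(θ - 1)/2 ‖z‖² + 1/2 ‖z + ζ‖² + θ/2 ⟪P ζ, ζ⟫` then decays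
exponentially: its derivative contains `-θ ⟪z, H z⟫ - ‖ζ‖²`, and the remaining terms are absorbed by
the lower bound on `ξ` and the choice of `ε`, with `θ = ξ` for `ξ ≥ 1` and `θ = 1` otherwise.
-/

namespace OptimalOutput

open Filter Set Topology

section RightDerivative

variable {F : Type*} [NormedAddCommGroup F] [NormedSpace ℝ F]

theorem hasDerivWithinAt_Icc_of_hasDerivWithinAt_Ici [CompleteSpace F] {X X' : ℝ → F} {a b s : ℝ}
    (hX : ContinuousOn X (Icc a b)) (hX' : ContinuousOn X' (Icc a b))
    (hd : ∀ r ∈ Ico a b, HasDerivWithinAt X (X' r) (Ici r) r) (hs : s ∈ Icc a b) :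
    HasDerivWithinAt X (X' s) (Icc a b) s := by
  have hint : ∀ r ∈ Icc a b, IntervalIntegrable X' MeasureTheory.volume a r := fun r hr =>
    (hX'.mono (Icc_subset_Icc_right hr.2)).intervalIntegrable_of_Icc hr.1
  have hftc : ∀ r ∈ Icc a b, X r = X a + ∫ p in a..r, X' p := by
    intro r hr
    rw [intervalIntegral.integral_eq_sub_of_hasDeriv_right_of_le hr.1
      (hX.mono (Icc_subset_Icc_right hr.2))
      (fun p hp => (hd p ⟨hp.1.le, hp.2.trans_le hr.2⟩).mono Ioi_subset_Ici_self) (hint r hr),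
      add_sub_cancel]
  have : Fact (s ∈ Icc a b) := ⟨hs⟩
  have hprim : HasDerivWithinAt (fun r => ∫ p in a..r, X' p) (X' s) (Icc a b) s :=
    intervalIntegral.integral_hasDerivWithinAt_right (hint s hs)
      (hX'.stronglyMeasurableAtFilter_nhdsWithin measurableSet_Icc s) (hX' s hs)
  exact (hprim.const_add (X a)).congr hftc (hftc s hs)

theorem gronwallBound_le_gronwallBound {δ K ε ε' x : ℝ} (hK : 0 ≤ K) (hx : 0 ≤ x) (hε : ε ≤ ε') :
    gronwallBound δ K ε x ≤ gronwallBound δ K ε' x := by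
  rcases hK.eq_or_lt with rfl | hK
  · simp only [gronwallBound_K0]
    gcongr
  · have hexp : 0 ≤ Real.exp (K * x) - 1 := sub_nonneg.2 (Real.one_le_exp (by positivity))
    simp only [gronwallBound_of_K_ne_0 hK.ne']
    gcongr

theorem norm_sub_le_gronwallBound_of_hasDerivWithinAt_Ici [CompleteSpace F] {X X' : ℝ → F}
    {a b K C : ℝ} (hab : a ≤ b) (hX : ContinuousOn X (Icc a b)) (hX' : ContinuousOn X' (Icc a b))
    (hd : ∀ r ∈ Ico a b, HasDerivWithinAt X (X' r) (Ici r) r) (hK : 0 ≤ K)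
    (hbound : ∀ r ∈ Icc a b, ‖X' r‖ ≤ K * ‖X r‖ + C) :
    ‖X a - X b‖ ≤ gronwallBound 0 K (K * ‖X b‖ + C) (b - a) := by
  have hmaps : MapsTo (fun r => a + b - r) (Icc a b) (Icc a b) := fun r hr =>
    ⟨by linarith [hr.2], by linarith [hr.1]⟩
  have hderiv : ∀ r ∈ Ico a b,
      HasDerivWithinAt (fun r => X (a + b - r) - X b) (-X' (a + b - r)) (Ici r) r := by
    intro r hr
    have hrev : HasDerivWithinAt (fun r : ℝ => a + b - r) (-1) (Icc a b) r :=
      (hasDerivWithinAt_id r _).const_sub (a + b)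
    have hcomp := (hasDerivWithinAt_Icc_of_hasDerivWithinAt_Ici hX hX' hd
      (hmaps ⟨hr.1, hr.2.le⟩)).scomp r hrev hmaps
    rw [neg_one_smul] at hcomp
    exact (hcomp.sub_const (X b)).mono_of_mem_nhdsWithin (Icc_mem_nhdsGE_of_mem hr)
  have hgrowth : ∀ r ∈ Ico a b,
      ‖-X' (a + b - r)‖ ≤ K * ‖X (a + b - r) - X b‖ + (K * ‖X b‖ + C) := by
    intro r hr
    have hnorm : ‖X (a + b - r)‖ ≤ ‖X (a + b - r) - X b‖ + ‖X b‖ := norm_le_norm_sub_add _ _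
    rw [norm_neg]
    linarith [hbound _ (hmaps ⟨hr.1, hr.2.le⟩), mul_le_mul_of_nonneg_left hnorm hK]
  simpa using norm_le_gronwallBound_of_norm_deriv_right_le
    ((hX.comp (by fun_prop) hmaps).sub continuousOn_const) hderiv (by simp) hgrowth b
    (right_mem_Icc.2 hab)

theorem le_mul_exp_of_hasDerivWithinAt_Ici_le {V V' : ℝ → ℝ} {r t : ℝ}
    (hV : ContinuousOn V (Ici 0)) (hd : ∀ s, 0 ≤ s → HasDerivWithinAt V (V' s) (Ici s) s)
    (hle : ∀ s, 0 ≤ s → V' s ≤ -r * V s) (ht : 0 ≤ t) : V t ≤ V 0 * Real.exp (-r * t) := by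
  have hslope : ∀ s ∈ Ico 0 t, ∀ p, V' s < p → ∃ᶠ y in 𝓝[>] s, (y - s)⁻¹ * (V y - V s) < p :=
    fun s hs _ hp => (hd s hs.1).liminf_right_slope_le hp
  simpa only [gronwallBound_ε0, sub_zero] using le_gronwallBound_of_liminf_deriv_right_le
    (hV.mono Icc_subset_Ici_self) hslope le_rfl
    (fun s hs => (hle s hs.1).trans_eq (add_zero _).symm) t (right_mem_Icc.2 ht)

end RightDerivative

section PositiveOperator

variable {E : Type*} [NormedAddCommGroup E] [InnerProductSpace ℝ E] {L : E →ₗ[ℝ] E} {l : ℝ}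

theorem norm_sq_apply_le_mul_inner (hL : L.IsPositive)
    (hle : ∀ v, inner ℝ (L v) v ≤ l * ‖v‖ ^ 2) (v : E) :
    ‖L v‖ ^ 2 ≤ l * inner ℝ (L v) v := by
  rcases (norm_nonneg (L v)).eq_or_lt with h0 | hpos
  · have hv : L v = 0 := norm_eq_zero.1 h0.symm
    simp [hv]
  have hform : ((innerₗ E).comp L).IsSymm :=
    ⟨fun x y => by simpa [real_inner_comm] using hL.isSymmetric x y⟩
  have hcs : (‖L v‖ ^ 2) ^ 2 ≤ inner ℝ (L v) v * inner ℝ (L (L v)) (L v) := by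
    simpa using LinearMap.BilinForm.apply_sq_le_of_symm ((innerₗ E).comp L)
      hL.inner_nonneg_left hform v (L v)
  have hlv := mul_le_mul_of_nonneg_left (hle (L v)) (hL.inner_nonneg_left v)
  exact le_of_mul_le_mul_right (by linarith) (pow_pos hpos 2)

theorem norm_apply_le_mul_norm (hL : L.IsPositive)
    (hle : ∀ v, inner ℝ (L v) v ≤ l * ‖v‖ ^ 2) (v : E) : ‖L v‖ ≤ l * ‖v‖ := by
  rcases eq_or_ne v 0 with rfl | hv
  · simp
  have hl : 0 ≤ l := nonneg_of_mul_nonneg_left ((hL.inner_nonneg_left v).trans (hle v))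
    (pow_pos (norm_pos_iff.2 hv) 2)
  refine (pow_le_pow_iff_left₀ (norm_nonneg _) (by positivity) two_ne_zero).1 ?_
  calc ‖L v‖ ^ 2 ≤ l * inner ℝ (L v) v := norm_sq_apply_le_mul_inner hL hle v
    _ ≤ l * (l * ‖v‖ ^ 2) := mul_le_mul_of_nonneg_left (hle v) hl
    _ = (l * ‖v‖) ^ 2 := by ring

theorem exists_symmetric_rightInverse [FiniteDimensional ℝ E] (hL : L.IsSymmetric) :
    ∃ P : E →L[ℝ] E, P.IsSymmetric ∧ ∀ v ∈ (LinearMap.ker L)ᗮ, L (P v) = v := by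
  let Q : E →ₗ[ℝ] E := ((LinearMap.ker L).starProjection : E →ₗ[ℝ] E)
  have hQmem (x : E) : Q x ∈ LinearMap.ker L := (LinearMap.ker L).starProjection_apply_mem x
  have hQsymm : Q.IsSymmetric := (LinearMap.ker L).starProjection_isSymmetric
  have horth (x y : E) : inner ℝ (L x) (Q y) = 0 := by
    rw [hL, LinearMap.mem_ker.1 (hQmem y), inner_zero_right]
  have hinj : Function.Injective (L + Q) := by
    refine (injective_iff_map_eq_zero _).2 fun x hx => ?_
    have hLx : L x = -Q x := eq_neg_of_add_eq_zero_left hx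
    have hQx : Q x = 0 := by simpa [hLx] using horth x x
    rw [hQx, neg_zero] at hLx
    rw [← (LinearMap.ker L).starProjection_eq_self_iff.2 (LinearMap.mem_ker.2 hLx)]
    exact hQx
  let e := LinearEquiv.ofInjectiveEndo (L + Q) hinj
  have he (x : E) : L (e.symm x) + Q (e.symm x) = x := e.apply_symm_apply x
  refine ⟨(e.symm : E →ₗ[ℝ] E).toContinuousLinearMap, fun x y => ?_, fun v hv => ?_⟩
  · change inner ℝ (e.symm x) y = inner ℝ x (e.symm y)
    conv_lhs => rw [← he y]
    conv_rhs => rw [← he x]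
    rw [inner_add_left, inner_add_right, hL, hQsymm]
  · have hQv : Q (e.symm v) = 0 := by
      have hvQ : inner ℝ (L (e.symm v) + Q (e.symm v)) (Q (e.symm v)) = 0 := by
        rw [he, real_inner_comm]
        exact hv _ (hQmem _)
      rw [inner_add_left, horth, zero_add] at hvQ
      exact inner_self_eq_zero.1 hvQ
    simpa [hQv] using he v

theorem mem_orthogonal_ker_of_hasDerivWithinAt_Ici (hL : L.IsSymmetric) {v ζ : ℝ → E} {t : ℝ}
    (hζ : ContinuousOn ζ (Ici 0)) (h0 : ζ 0 ∈ (LinearMap.ker L)ᗮ)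
    (hd : ∀ s, 0 ≤ s → HasDerivWithinAt ζ (L (v s)) (Ici s) s) (ht : 0 ≤ t) :
    ζ t ∈ (LinearMap.ker L)ᗮ := by
  intro x hx
  have hderiv : ∀ s ∈ Ico 0 t, HasDerivWithinAt (fun r => inner ℝ x (ζ r)) 0 (Ici s) s := by
    intro s hs
    have hinner := (hasDerivWithinAt_const s (Ici s) x).inner ℝ (hd s hs.1)
    rwa [← hL, LinearMap.mem_ker.1 hx, inner_zero_left, inner_zero_left, add_zero] at hinner
  exact (constant_of_has_deriv_right_zero
    (continuousOn_const.inner (hζ.mono Icc_subset_Ici_self)) hderiv t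
    (right_mem_Icc.2 ht)).trans (h0 x hx)

end PositiveOperator

section Scalar

/-- The bound on the derivative of the Lyapunov function with weight `θ`, in terms of the norms `a`
of the output error, `b` of the integral error and `c` of the sampling error. -/
def dissipationBound (m w l θ a b c : ℝ) : ℝ :=
  -(θ * m * a ^ 2) + (θ - 1) * (l * a * c) + w * a * b - b ^ 2 + θ * (c * b)

variable {m w l ξ a b c : ℝ}

theorem eight_mul_dissipationBound_le
    (hc : 8 * (ξ ^ 2 + (ξ - 1) ^ 2) * c ^ 2 ≤ a ^ 2 + b ^ 2) :
    8 * dissipationBound m w l ξ a b c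
      ≤ -((8 * m * ξ - 4 * w ^ 2 - 2 * l ^ 2 - 1) * a ^ 2 + b ^ 2) := by
  unfold dissipationBound
  linarith [sq_nonneg (l * a / 2 - (ξ - 1) * c), sq_nonneg (b / 2 - ξ * c), sq_nonneg (w * a - b)]

theorem eight_mul_mul_dissipationBound_one_le (hξ : 0 ≤ ξ)
    (hc : 8 * (ξ ^ 2 + (ξ - 1) ^ 2) * c ^ 2 ≤ a ^ 2 + b ^ 2) :
    8 * ξ * dissipationBound m w l 1 a b c
      ≤ -((8 * m * ξ - 4 * w ^ 2 - 1) * a ^ 2 + (16 / 3 * ξ - 4 * ξ ^ 2 - 1) * b ^ 2) := by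
  have hξc : 6 * ξ * c ^ 2 ≤ a ^ 2 + b ^ 2 := by
    have : 6 * ξ ≤ 8 * (ξ ^ 2 + (ξ - 1) ^ 2) := by nlinarith [sq_nonneg (ξ - 11 / 16)]
    linarith [mul_le_mul_of_nonneg_right this (sq_nonneg c)]
  have hcb : ξ * (8 * (c * b)) ≤ ξ * (8 / 3 * b ^ 2 + 6 * c ^ 2) :=
    mul_le_mul_of_nonneg_left (by linarith [sq_nonneg (2 * b - 3 * c)]) hξ
  unfold dissipationBound
  linarith [sq_nonneg (w * a - ξ * b)]

theorem min_mul_sq_add_sq_le (p r a b : ℝ) :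
    min p r * (a ^ 2 + b ^ 2) ≤ p * a ^ 2 + r * b ^ 2 := by
  rw [mul_add]
  gcongr
  exacts [min_le_left p r, min_le_right p r]

-- The natural weight is `θ = ξ`. For `ξ < 1` it would make the coefficient `θ - 1` negative;
-- `θ = 1` removes that coefficient, and the term in `l` with it.
theorem exists_dissipationBound_le (hm : 0 < m) (hmw : m ≤ w)
    (hξ : 4 * w ^ 2 + 2 * l ^ 2 + 1 < 8 * m * ξ) :
    ∃ θ δ : ℝ, 1 ≤ θ ∧ 0 < δ ∧ ∀ a b c : ℝ,
      8 * (ξ ^ 2 + (ξ - 1) ^ 2) * c ^ 2 ≤ a ^ 2 + b ^ 2 →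
        dissipationBound m w l θ a b c ≤ -(δ * (a ^ 2 + b ^ 2)) := by
  rcases le_or_gt 1 ξ with hξ1 | hξ1
  · refine ⟨ξ, min (8 * m * ξ - 4 * w ^ 2 - 2 * l ^ 2 - 1) 1 / 8, hξ1,
      div_pos (lt_min (by linarith) one_pos) (by norm_num), fun a b c hc => ?_⟩
    linarith [eight_mul_dissipationBound_le (m := m) (w := w) (l := l) hc,
      min_mul_sq_add_sq_le (8 * m * ξ - 4 * w ^ 2 - 2 * l ^ 2 - 1) 1 a b]
  · have hξ2 : 1 / 2 < ξ := by
      refine lt_of_mul_lt_mul_left ?_ hm.le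
      linarith [sq_nonneg (2 * w - 1), sq_nonneg l]
    have hξ0 : 0 < ξ := one_half_pos.trans hξ2
    have hδ : 0 < min (8 * m * ξ - 4 * w ^ 2 - 1) (16 / 3 * ξ - 4 * ξ ^ 2 - 1) :=
      lt_min (by linarith [sq_nonneg l]) (by linarith [mul_pos (sub_pos.2 hξ1) (sub_pos.2 hξ2)])
    refine ⟨1, _, le_rfl, div_pos hδ (by positivity : 0 < 8 * ξ), fun a b c hc => ?_⟩
    refine le_of_mul_le_mul_left ?_ (by positivity : 0 < 8 * ξ)
    rw [mul_neg, ← mul_assoc, mul_div_cancel₀ _ (by positivity)]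
    linarith [eight_mul_mul_dissipationBound_one_le (m := m) (w := w) (l := l) hξ0.le hc,
      min_mul_sq_add_sq_le (8 * m * ξ - 4 * w ^ 2 - 1) (16 / 3 * ξ - 4 * ξ ^ 2 - 1) a b]

theorem epsilon_nonneg (ξ : ℝ) : 0 ≤ epsilon ξ := by
  unfold epsilon
  positivity

theorem eight_mul_mul_epsilon_sq (ξ : ℝ) : 8 * (ξ ^ 2 + (ξ - 1) ^ 2) * epsilon ξ ^ 2 = 1 := by
  have hpos : 0 < ξ ^ 2 + (ξ - 1) ^ 2 := by nlinarith [sq_nonneg (2 * ξ - 1)]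
  rw [epsilon, div_pow, mul_pow, Real.sq_sqrt (by positivity)]
  field_simp
  norm_num

theorem exp_sub_one_le_of_le_tau0 {t : ℝ} (hw : 0 ≤ w) (hl : 0 ≤ l) (ht : t ≤ tau0 w l ξ) :
    Real.exp ((w + 1) * t) - 1
      ≤ (w + 1) * epsilon ξ / (w + 1 + √2 * l + √2 * l * epsilon ξ) := by
  have hε := epsilon_nonneg ξ
  rw [sub_le_iff_le_add', ← Real.le_log_iff_exp_le (by positivity)]
  rwa [tau0, one_div, le_inv_mul_iff₀ (by positivity)] at ht

-- `tau0` is the time at which this implicit Grönwall estimate stops giving `c ≤ ε x`.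
theorem le_epsilon_mul_of_le_gronwallBound {x t : ℝ} (hw : 0 ≤ w) (hl : 0 ≤ l) (hx : 0 ≤ x)
    (hc : 0 ≤ c) (ht : t ≤ tau0 w l ξ)
    (hle : c ≤ gronwallBound 0 (w + 1) ((w + 1) * x + √2 * l * (x + c)) t) :
    c ≤ epsilon ξ * x := by
  have hε := epsilon_nonneg ξ
  have hbound : c ≤ ((w + 1) * x + √2 * l * (x + c)) * epsilon ξ
      / (w + 1 + √2 * l + √2 * l * epsilon ξ) :=
    calc c ≤ ((w + 1) * x + √2 * l * (x + c)) / (w + 1) * (Real.exp ((w + 1) * t) - 1) := by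
          simpa [gronwallBound_of_K_ne_0 (by positivity : w + 1 ≠ 0)] using hle
      _ ≤ ((w + 1) * x + √2 * l * (x + c)) / (w + 1)
          * ((w + 1) * epsilon ξ / (w + 1 + √2 * l + √2 * l * epsilon ξ)) := by
        gcongr
        exact exp_sub_one_le_of_le_tau0 hw hl ht
      _ = _ := by field_simp
  rw [le_div_iff₀ (by positivity)] at hbound
  exact le_of_mul_le_mul_left (by linarith) (by positivity : 0 < w + 1 + √2 * l)

end Scalar

section Sampling

/-- Sampling instants `T 0 = 0 ≤ T 1 ≤ ⋯`, increasing to infinity with gaps at most `τ`. -/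
structure IsSamplingSequence (τ : ℝ) (T : ℕ → ℝ) : Prop where
  zero : T 0 = 0
  monotone : Monotone T
  gap_le : ∀ k, T (k + 1) - T k ≤ τ
  tendsto : Tendsto T atTop atTop

variable {τ : ℝ} {T : ℕ → ℝ}

theorem IsSamplingSequence.nonneg (hT : IsSamplingSequence τ T) (k : ℕ) : 0 ≤ T k :=
  hT.zero.symm.trans_le (hT.monotone k.zero_le)

theorem IsSamplingSequence.exists_mem_Ico (hT : IsSamplingSequence τ T) {t : ℝ} (ht : 0 ≤ t) :
    ∃ k, t ∈ Ico (T k) (T (k + 1)) := by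
  classical
  have hex : ∃ k, t < T k := (hT.tendsto.eventually_gt_atTop t).exists
  have hpos : Nat.find hex ≠ 0 := fun h => (hT.zero ▸ h ▸ Nat.find_spec hex).not_ge ht
  obtain ⟨k, hk⟩ := Nat.exists_eq_succ_of_ne_zero hpos
  exact ⟨k, not_lt.1 (Nat.find_min hex (hk ▸ k.lt_succ_self)),
    (Nat.find_spec hex).trans_eq (congrArg T hk)⟩

theorem eq_natCast_mul_of_add {Δ : ℝ} (h0 : T 0 = 0) (hs : ∀ k, T (k + 1) = T k + Δ) :
    T = fun k : ℕ => k * Δ := by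
  funext k
  induction k with
  | zero => simp [h0]
  | succ k ih => rw [hs, ih, Nat.cast_succ, add_one_mul]

theorem isSamplingSequence_natCast_mul {Δ : ℝ} (hΔ : Δ ∈ Ioc 0 τ) :
    IsSamplingSequence τ fun k => k * Δ where
  zero := by simp
  monotone := Nat.mono_cast.mul_const hΔ.1.le
  gap_le k := by simpa [add_one_mul] using hΔ.2
  tendsto := tendsto_natCast_atTop_atTop.atTop_mul_const hΔ.1

end Sampling

section SampledData

variable {E : Type*} [NormedAddCommGroup E]

theorem norm_toLp_neg_sub_sub_le {w l : ℝ} (hw : 0 ≤ w) {z ζ h v p : E}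
    (hh : ‖h‖ ≤ w * ‖z‖) (hp : ‖p‖ ≤ l * ‖v‖) :
    ‖WithLp.toLp 2 (-h - p - ζ, p)‖ ≤ (w + 1) * ‖WithLp.toLp 2 (z, ζ)‖ + √2 * l * ‖v‖ := by
  have hz : ‖z‖ ≤ ‖WithLp.toLp 2 (z, ζ)‖ := WithLp.norm_fst_le E (WithLp.toLp 2 (z, ζ))
  have hζ : ‖ζ‖ ≤ ‖WithLp.toLp 2 (z, ζ)‖ := WithLp.norm_snd_le E (WithLp.toLp 2 (z, ζ))
  have hpp : ‖WithLp.toLp 2 (-p, p)‖ = √2 * ‖p‖ := by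
    rw [WithLp.prod_norm_eq_of_L2, WithLp.toLp_fst, WithLp.toLp_snd, norm_neg, ← two_mul,
      Real.sqrt_mul zero_le_two, Real.sqrt_sq (norm_nonneg _)]
  have hsplit : WithLp.toLp 2 (-h - p - ζ, p)
      = WithLp.toLp 2 (-h - ζ, (0 : E)) + WithLp.toLp 2 (-p, p) := by
    rw [← WithLp.toLp_add, Prod.mk_add_mk, zero_add, sub_right_comm, sub_eq_add_neg _ p]
  calc ‖WithLp.toLp 2 (-h - p - ζ, p)‖
      ≤ ‖-h - ζ‖ + √2 * ‖p‖ := by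
        rw [hsplit, ← hpp, ← WithLp.norm_toLp_fst 2 E E (-h - ζ)]
        exact norm_add_le _ _
    _ ≤ (‖h‖ + ‖ζ‖) + √2 * ‖p‖ := by
        gcongr
        simpa using norm_sub_le (-h) ζ
    _ ≤ (w * ‖WithLp.toLp 2 (z, ζ)‖ + ‖WithLp.toLp 2 (z, ζ)‖) + √2 * (l * ‖v‖) := by
        gcongr
        exact hh.trans (by gcongr)
    _ = (w + 1) * ‖WithLp.toLp 2 (z, ζ)‖ + √2 * l * ‖v‖ := by ring

variable [InnerProductSpace ℝ E]

/-- `z, ζ` solve on `[0, ∞)` the error system `ż = -H z - L ẑ - ζ`, `ζ̇ = L ẑ`, where `ẑ` holds the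
value of `z` at the last sampling instant `T k`; as `ẑ` jumps, the derivatives are right
derivatives. -/
structure IsSampledSolution (L : E →ₗ[ℝ] E) (H : E → E) (T : ℕ → ℝ) (z zhat ζ : ℝ → E) :
    Prop where
  continuousOn_fst : ContinuousOn z (Ici 0)
  continuousOn_snd : ContinuousOn ζ (Ici 0)
  hold : ∀ k, ∀ t ∈ Ico (T k) (T (k + 1)), zhat t = z (T k)
  deriv_fst : ∀ t, 0 ≤ t → HasDerivWithinAt z (-H (z t) - L (zhat t) - ζ t) (Ici t) t
  deriv_snd : ∀ t, 0 ≤ t → HasDerivWithinAt ζ (L (zhat t)) (Ici t) t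
  mem_orthogonal : ∀ t, 0 ≤ t → ζ t ∈ (LinearMap.ker L)ᗮ

variable {L : E →ₗ[ℝ] E} {H : E → E} {T : ℕ → ℝ} {z zhat ζ : ℝ → E} {w l ξ : ℝ}

theorem IsSampledSolution.norm_sub_le_gronwallBound [CompleteSpace E]
    (hsol : IsSampledSolution L H T z zhat ζ) (hL : ∀ v, ‖L v‖ ≤ l * ‖v‖) (hHc : Continuous H)
    (hw : 0 ≤ w) (hH : ∀ v, ‖H v‖ ≤ w * ‖v‖) {k : ℕ} {t : ℝ} (hk : 0 ≤ T k)
    (ht : t ∈ Ico (T k) (T (k + 1))) :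
    ‖WithLp.toLp 2 (z (T k), ζ (T k)) - WithLp.toLp 2 (z t, ζ t)‖
      ≤ gronwallBound 0 (w + 1) ((w + 1) * ‖WithLp.toLp 2 (z t, ζ t)‖ + √2 * l * ‖z (T k)‖)
        (t - T k) := by
  let φ := (WithLp.prodContinuousLinearEquiv 2 ℝ E E).symm
  have hsub : Icc (T k) t ⊆ Ici 0 := fun s hs => hk.trans hs.1
  have hzc := hsol.continuousOn_fst.mono hsub
  have hζc := hsol.continuousOn_snd.mono hsub
  have hderiv : ∀ s ∈ Ico (T k) t, HasDerivWithinAt (fun r => φ (z r, ζ r))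
      (φ (-H (z s) - L (z (T k)) - ζ s, L (z (T k)))) (Ici s) s := by
    intro s hs
    rw [← hsol.hold k s ⟨hs.1, hs.2.trans ht.2⟩]
    exact (φ : E × E →L[ℝ] WithLp 2 (E × E)).hasFDerivAt.comp_hasDerivWithinAt s
      ((hsol.deriv_fst s (hk.trans hs.1)).prodMk (hsol.deriv_snd s (hk.trans hs.1)))
  exact norm_sub_le_gronwallBound_of_hasDerivWithinAt_Ici ht.1
    (φ.continuous.comp_continuousOn (hzc.prodMk hζc))
    (φ.continuous.comp_continuousOn
      ((((hHc.comp_continuousOn hzc).neg.sub continuousOn_const).sub hζc).prodMk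
        continuousOn_const)) hderiv (by positivity)
    fun s _ => norm_toLp_neg_sub_sub_le hw (hH _) (hL _)

theorem IsSampledSolution.sampling_error_le [CompleteSpace E]
    (hsol : IsSampledSolution L H T z zhat ζ) (hT : IsSamplingSequence (tau0 w l ξ) T)
    (hl : 0 ≤ l) (hL : ∀ v, ‖L v‖ ≤ l * ‖v‖) (hHc : Continuous H) (hw : 0 ≤ w)
    (hH : ∀ v, ‖H v‖ ≤ w * ‖v‖) {t : ℝ} (ht : 0 ≤ t) :
    8 * (ξ ^ 2 + (ξ - 1) ^ 2) * ‖zhat t - z t‖ ^ 2 ≤ ‖z t‖ ^ 2 + ‖ζ t‖ ^ 2 := by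
  obtain ⟨k, hk⟩ := hT.exists_mem_Ico ht
  rw [hsol.hold k t hk]
  have hgron := hsol.norm_sub_le_gronwallBound hL hHc hw hH (hT.nonneg k) hk
  have hfst : ‖z (T k) - z t‖
      ≤ ‖WithLp.toLp 2 (z (T k), ζ (T k)) - WithLp.toLp 2 (z t, ζ t)‖ :=
    WithLp.norm_fst_le E (WithLp.toLp 2 (z (T k), ζ (T k)) - WithLp.toLp 2 (z t, ζ t))
  have hheld : ‖z (T k)‖ ≤ ‖WithLp.toLp 2 (z t, ζ t)‖ + ‖z (T k) - z t‖ := by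
    rw [add_comm]
    refine (norm_le_norm_sub_add _ (z t)).trans (add_le_add_right ?_ _)
    exact WithLp.norm_fst_le E (WithLp.toLp 2 (z t, ζ t))
  have herr : ‖z (T k) - z t‖ ≤ epsilon ξ * ‖WithLp.toLp 2 (z t, ζ t)‖ := by
    refine le_epsilon_mul_of_le_gronwallBound hw hl (norm_nonneg _) (norm_nonneg _)
      ((sub_le_sub_right hk.2.le _).trans (hT.gap_le k)) (hfst.trans (hgron.trans ?_))
    exact gronwallBound_le_gronwallBound (by positivity) (sub_nonneg.2 hk.1) (by gcongr)
  calc 8 * (ξ ^ 2 + (ξ - 1) ^ 2) * ‖z (T k) - z t‖ ^ 2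
      ≤ 8 * (ξ ^ 2 + (ξ - 1) ^ 2) * (epsilon ξ * ‖WithLp.toLp 2 (z t, ζ t)‖) ^ 2 := by gcongr
    _ = ‖WithLp.toLp 2 (z t, ζ t)‖ ^ 2 := by
        rw [mul_pow, ← mul_assoc, eight_mul_mul_epsilon_sq, one_mul]
    _ = ‖z t‖ ^ 2 + ‖ζ t‖ ^ 2 := WithLp.prod_norm_sq_eq_of_L2 _

end SampledData

section Lyapunov

theorem le_sqrt_mul_exp_of_sq_le {x b r t : ℝ} (h : x ^ 2 ≤ b * Real.exp (-r * t)) :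
    x ≤ √b * Real.exp (-(r / 2) * t) := by
  refine (Real.le_sqrt_of_sq_le h).trans_eq ?_
  rw [Real.sqrt_mul' _ (Real.exp_pos _).le, ← Real.exp_half, mul_div_right_comm, neg_div]

variable {E : Type*} [NormedAddCommGroup E]

theorem norm_add_sq_le_two_mul (x y : E) : ‖x + y‖ ^ 2 ≤ 2 * (‖x‖ ^ 2 + ‖y‖ ^ 2) :=
  (pow_le_pow_left₀ (norm_nonneg _) (norm_add_le x y) 2).trans add_sq_le

variable [InnerProductSpace ℝ E]

/-- The Lyapunov function with weight `θ` of the error system `ż = -H z - L ẑ - ζ`, `ζ̇ = L ẑ`,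
where `P` is a symmetric inverse of `L` on the orthogonal complement of its kernel: with this `P`
the indefinite cross terms in `z` and `ζ` cancel in the derivative. -/
noncomputable def lyapunov (P : E →L[ℝ] E) (θ : ℝ) (z ζ : E) : ℝ :=
  (θ - 1) / 2 * ‖z‖ ^ 2 + 1 / 2 * ‖z + ζ‖ ^ 2 + θ / 2 * inner ℝ (P ζ) ζ

variable {P : E →L[ℝ] E} {L : E →ₗ[ℝ] E} {H : E → E} {m w l ξ θ δ : ℝ}

theorem lyapunov_le (hθ : 1 ≤ θ) (z ζ : E) :
    lyapunov P θ z ζ ≤ ((θ - 1) / 2 + 1 + θ / 2 * ‖P‖) * (‖z‖ ^ 2 + ‖ζ‖ ^ 2) := by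
  have hP : inner ℝ (P ζ) ζ ≤ ‖P‖ * (‖z‖ ^ 2 + ‖ζ‖ ^ 2) :=
    calc inner ℝ (P ζ) ζ ≤ ‖P ζ‖ * ‖ζ‖ := real_inner_le_norm _ _
      _ ≤ ‖P‖ * ‖ζ‖ * ‖ζ‖ := by gcongr; exact P.le_opNorm ζ
      _ = ‖P‖ * ‖ζ‖ ^ 2 := by ring
      _ ≤ ‖P‖ * (‖z‖ ^ 2 + ‖ζ‖ ^ 2) := by gcongr; exact le_add_of_nonneg_left (sq_nonneg _)
  have : 0 ≤ (θ - 1) / 2 := by linarith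
  calc lyapunov P θ z ζ
      ≤ (θ - 1) / 2 * (‖z‖ ^ 2 + ‖ζ‖ ^ 2) + 1 / 2 * (2 * (‖z‖ ^ 2 + ‖ζ‖ ^ 2))
        + θ / 2 * (‖P‖ * (‖z‖ ^ 2 + ‖ζ‖ ^ 2)) := by
        unfold lyapunov
        gcongr
        exacts [le_add_of_nonneg_right (sq_nonneg _), norm_add_sq_le_two_mul z ζ]
    _ = ((θ - 1) / 2 + 1 + θ / 2 * ‖P‖) * (‖z‖ ^ 2 + ‖ζ‖ ^ 2) := by ring

theorem norm_sq_le_mul_lyapunov (hL : L.IsPositive) (hle : ∀ v, inner ℝ (L v) v ≤ l * ‖v‖ ^ 2)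
    (hl : 0 ≤ l) (hθ : 1 ≤ θ) {ζ : E} (hζ : L (P ζ) = ζ) (z : E) :
    ‖z‖ ^ 2 ≤ 4 * (1 + l) * lyapunov P θ z ζ := by
  have hp : 0 ≤ inner ℝ (P ζ) ζ := by simpa [hζ] using hL.inner_nonneg_right (P ζ)
  have hζp : ‖ζ‖ ^ 2 ≤ l * inner ℝ (P ζ) ζ := by
    simpa [hζ, real_inner_comm] using norm_sq_apply_le_mul_inner hL hle (P ζ)
  have hz : ‖z‖ ^ 2 ≤ 2 * (‖z + ζ‖ ^ 2 + ‖ζ‖ ^ 2) := by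
    simpa using norm_add_sq_le_two_mul (z + ζ) (-ζ)
  have hV : ‖z + ζ‖ ^ 2 + inner ℝ (P ζ) ζ ≤ 2 * lyapunov P θ z ζ := by
    unfold lyapunov
    linarith [mul_nonneg (sub_nonneg.2 hθ) (sq_nonneg ‖z‖), mul_nonneg (sub_nonneg.2 hθ) hp]
  calc ‖z‖ ^ 2 ≤ 2 * (‖z + ζ‖ ^ 2 + l * inner ℝ (P ζ) ζ) := hz.trans (by gcongr)
    _ ≤ 2 * ((1 + l) * (‖z + ζ‖ ^ 2 + inner ℝ (P ζ) ζ)) := by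
        linarith [mul_nonneg hl (sq_nonneg ‖z + ζ‖)]
    _ ≤ 2 * ((1 + l) * (2 * lyapunov P θ z ζ)) := by gcongr
    _ = 4 * (1 + l) * lyapunov P θ z ζ := by ring

theorem hasDerivWithinAt_lyapunov (hP : P.IsSymmetric) {z ζ : ℝ → E} {z' ζ' : E} {s : Set ℝ}
    {t : ℝ} (hz : HasDerivWithinAt z z' s t) (hζ : HasDerivWithinAt ζ ζ' s t) :
    HasDerivWithinAt (fun r => lyapunov P θ (z r) (ζ r))
      ((θ - 1) * inner ℝ (z t) z' + inner ℝ (z t + ζ t) (z' + ζ')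
        + θ * inner ℝ (P (ζ t)) ζ') s t := by
  have hPζ : HasDerivWithinAt (fun r => P (ζ r)) (P ζ') s t :=
    P.hasFDerivAt.comp_hasDerivWithinAt t hζ
  refine (((hz.norm_sq.const_mul ((θ - 1) / 2)).add ((hz.add hζ).norm_sq.const_mul (1 / 2))).add
    ((hPζ.inner ℝ hζ).const_mul (θ / 2))).congr_deriv ?_
  have hsymm : inner ℝ (P ζ') (ζ t) = inner ℝ (P (ζ t)) ζ' := by
    rw [real_inner_comm]
    exact (hP (ζ t) ζ').symm
  rw [hsymm, Pi.add_apply]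
  ring

theorem continuousOn_lyapunov {z ζ : ℝ → E} {s : Set ℝ} (hz : ContinuousOn z s)
    (hζ : ContinuousOn ζ s) : ContinuousOn (fun r => lyapunov P θ (z r) (ζ r)) s := by
  unfold lyapunov
  fun_prop

theorem lyapunov_deriv_eq (hL : L.IsSymmetric) {ζ : E} (hζ : L (P ζ) = ζ) (z v h : E) :
    (θ - 1) * inner ℝ z (-h - L v - ζ) + inner ℝ (z + ζ) (-h - L v - ζ + L v)
        + θ * inner ℝ (P ζ) (L v)
      = -(θ * inner ℝ z h) - (θ - 1) * inner ℝ z (L z) - (θ - 1) * inner ℝ z (L (v - z))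
        - inner ℝ ζ h - ‖ζ‖ ^ 2 + θ * inner ℝ ζ (v - z) := by
  rw [← hL (P ζ), hζ, show -h - L v - ζ + L v = -h - ζ by abel]
  simp only [map_sub, inner_sub_right, inner_neg_right, inner_add_left, real_inner_self_eq_norm_sq,
    real_inner_comm ζ z]
  ring

theorem lyapunov_deriv_le (hL : L.IsPositive) (hle : ∀ v, inner ℝ (L v) v ≤ l * ‖v‖ ^ 2)
    (hθ : 1 ≤ θ) {z ζ h : E} (hζ : L (P ζ) = ζ) (hm : m * ‖z‖ ^ 2 ≤ inner ℝ z h)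
    (hw : ‖h‖ ≤ w * ‖z‖) (v : E) :
    (θ - 1) * inner ℝ z (-h - L v - ζ) + inner ℝ (z + ζ) (-h - L v - ζ + L v)
        + θ * inner ℝ (P ζ) (L v)
      ≤ dissipationBound m w l θ ‖z‖ ‖ζ‖ ‖v - z‖ := by
  have hLe : -inner ℝ z (L (v - z)) ≤ l * ‖z‖ * ‖v - z‖ :=
    calc -inner ℝ z (L (v - z)) ≤ ‖z‖ * ‖L (v - z)‖ :=
          (neg_le_abs _).trans (abs_real_inner_le_norm _ _)
      _ ≤ ‖z‖ * (l * ‖v - z‖) := by gcongr; exact norm_apply_le_mul_norm hL hle _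
      _ = l * ‖z‖ * ‖v - z‖ := by ring
  have hζh : -inner ℝ ζ h ≤ w * ‖z‖ * ‖ζ‖ :=
    calc -inner ℝ ζ h ≤ ‖ζ‖ * ‖h‖ := (neg_le_abs _).trans (abs_real_inner_le_norm _ _)
      _ ≤ ‖ζ‖ * (w * ‖z‖) := by gcongr
      _ = w * ‖z‖ * ‖ζ‖ := by ring
  have hζe : inner ℝ ζ (v - z) ≤ ‖v - z‖ * ‖ζ‖ :=
    (real_inner_le_norm _ _).trans_eq (mul_comm _ _)
  have hθ0 : 0 ≤ θ := zero_le_one.trans hθ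
  have hθ1 : 0 ≤ θ - 1 := sub_nonneg.2 hθ
  rw [lyapunov_deriv_eq hL.isSymmetric hζ, dissipationBound]
  linarith [mul_le_mul_of_nonneg_left hm hθ0, mul_nonneg hθ1 (hL.inner_nonneg_right z),
    mul_le_mul_of_nonneg_left hLe hθ1, mul_le_mul_of_nonneg_left hζe hθ0]

variable {T : ℕ → ℝ} {z zhat ζ : ℝ → E}

theorem IsSampledSolution.lyapunov_le_mul_exp [CompleteSpace E]
    (hsol : IsSampledSolution L H T z zhat ζ) (hL : L.IsPositive)
    (hle : ∀ v, inner ℝ (L v) v ≤ l * ‖v‖ ^ 2) (hP : P.IsSymmetric)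
    (hLP : ∀ v ∈ (LinearMap.ker L)ᗮ, L (P v) = v)
    (hm : ∀ v, m * ‖v‖ ^ 2 ≤ inner ℝ v (H v)) (hw : ∀ v, ‖H v‖ ≤ w * ‖v‖)
    (hθ : 1 ≤ θ) (hδ : 0 ≤ δ)
    (hdiss : ∀ t, 0 ≤ t → dissipationBound m w l θ ‖z t‖ ‖ζ t‖ ‖zhat t - z t‖
      ≤ -(δ * (‖z t‖ ^ 2 + ‖ζ t‖ ^ 2))) {t : ℝ} (ht : 0 ≤ t) :
    lyapunov P θ (z t) (ζ t) ≤ lyapunov P θ (z 0) (ζ 0)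
      * Real.exp (-(δ / ((θ - 1) / 2 + 1 + θ / 2 * ‖P‖)) * t) := by
  have hC : 0 < (θ - 1) / 2 + 1 + θ / 2 * ‖P‖ :=
    add_pos_of_pos_of_nonneg (by linarith) (by positivity)
  refine le_mul_exp_of_hasDerivWithinAt_Ici_le
    (continuousOn_lyapunov hsol.continuousOn_fst hsol.continuousOn_snd)
    (fun s hs => hasDerivWithinAt_lyapunov hP (hsol.deriv_fst s hs) (hsol.deriv_snd s hs))
    (fun s hs => ?_) ht
  refine (lyapunov_deriv_le hL hle hθ (hLP _ (hsol.mem_orthogonal s hs)) (hm _) (hw _) _).trans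
    ((hdiss s hs).trans ?_)
  rw [neg_mul, neg_le_neg_iff, div_mul_eq_mul_div, div_le_iff₀ hC, mul_assoc]
  gcongr
  exact (lyapunov_le hθ _ _).trans_eq (mul_comm _ _)

theorem exists_norm_le_mul_exp_of_isSampledSolution [FiniteDimensional ℝ E] (hL : L.IsPositive)
    (hle : ∀ v, inner ℝ (L v) v ≤ l * ‖v‖ ^ 2) (hm : 0 < m)
    (hξ : 4 * w ^ 2 + 2 * l ^ 2 + 1 < 8 * m * ξ) (hHc : Continuous H)
    (hHm : ∀ v, m * ‖v‖ ^ 2 ≤ inner ℝ v (H v)) (hHw : ∀ v, ‖H v‖ ≤ w * ‖v‖) :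
    ∃ c : ℝ, 0 < c ∧ ∀ T, IsSamplingSequence (tau0 w l ξ) T →
      ∀ z zhat ζ, IsSampledSolution L H T z zhat ζ →
        ∃ M : ℝ, ∀ t, 0 ≤ t → ‖z t‖ ≤ M * Real.exp (-c * t) := by
  rcases subsingleton_or_nontrivial E with hE | hE
  · exact ⟨1, one_pos, fun _ _ _ _ _ _ => ⟨0, fun t _ => by simp [Subsingleton.elim _ (0 : E)]⟩⟩
  obtain ⟨v, hv⟩ := exists_ne (0 : E)
  have hv2 : 0 < ‖v‖ ^ 2 := pow_pos (norm_pos_iff.2 hv) 2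
  have hl : 0 ≤ l := nonneg_of_mul_nonneg_left ((hL.inner_nonneg_left v).trans (hle v)) hv2
  have hmw : m ≤ w := by
    refine le_of_mul_le_mul_right ?_ hv2
    calc m * ‖v‖ ^ 2 ≤ ‖v‖ * ‖H v‖ := (hHm v).trans (real_inner_le_norm _ _)
      _ ≤ ‖v‖ * (w * ‖v‖) := by gcongr; exact hHw v
      _ = w * ‖v‖ ^ 2 := by ring
  obtain ⟨P, hP, hLP⟩ := exists_symmetric_rightInverse hL.isSymmetric
  obtain ⟨θ, δ, hθ, hδ, hdiss⟩ := exists_dissipationBound_le (l := l) hm hmw hξ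
  have : 0 < (θ - 1) / 2 + 1 + θ / 2 * ‖P‖ :=
    add_pos_of_pos_of_nonneg (by linarith) (by positivity)
  refine ⟨δ / ((θ - 1) / 2 + 1 + θ / 2 * ‖P‖) / 2, by positivity, fun T hT z zhat ζ hsol =>
    ⟨√(4 * (1 + l) * lyapunov P θ (z 0) (ζ 0)), fun t ht => ?_⟩⟩
  have hV := hsol.lyapunov_le_mul_exp hL hle hP hLP hHm hHw hθ hδ.le (fun s hs => hdiss _ _ _
    (hsol.sampling_error_le hT hl (norm_apply_le_mul_norm hL hle) hHc (hm.le.trans hmw) hHw hs)) ht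
  refine le_sqrt_mul_exp_of_sq_le ?_
  calc ‖z t‖ ^ 2 ≤ 4 * (1 + l) * lyapunov P θ (z t) (ζ t) :=
        norm_sq_le_mul_lyapunov hL hle hl hθ (hLP _ (hsol.mem_orthogonal t ht)) (z t)
    _ ≤ 4 * (1 + l) * (lyapunov P θ (z 0) (ζ 0) * _) := by gcongr
    _ = 4 * (1 + l) * lyapunov P θ (z 0) (ζ 0) * _ := (mul_assoc _ _ _).symm

end Lyapunov

section Laplacian

theorem posSemidef_sSup_spectrum_sub {n : Type*} [Fintype n] [DecidableEq n] {A : Matrix n n ℝ}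
    (hA : A.IsHermitian) : (algebraMap ℝ (Matrix n n ℝ) (sSup (spectrum ℝ A)) - A).PosSemidef := by
  refine Matrix.posSemidef_iff_isHermitian_and_spectrum_nonneg.2 ⟨?_, ?_⟩
  · rw [Matrix.algebraMap_eq_diagonal]
    exact (Matrix.isHermitian_diagonal _).sub hA
  · rw [← spectrum.singleton_sub_eq]
    rintro _ ⟨_, rfl, r, hr, rfl⟩
    have hbdd : BddAbove (spectrum ℝ A) := by
      rw [hA.spectrum_real_eq_range_eigenvalues]
      exact (finite_range _).bddAbove
    exact sub_nonneg.2 (le_csSup hbdd hr)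

variable {W : Type*} [NormedAddCommGroup W] [InnerProductSpace ℝ W]

theorem sum_mul_inner_nonneg {n : Type*} [Fintype n] {M : Matrix n n ℝ} (hM : M.PosSemidef)
    (x : n → W) : 0 ≤ ∑ i, ∑ j, M i j * inner ℝ (x i) (x j) := by
  -- The Schur product of `M` with the Gram matrix of `x` is positive semidefinite.
  have h := (hM.hadamard (Matrix.posSemidef_gram ℝ x)).dotProduct_mulVec_nonneg fun _ => 1
  simpa [dotProduct, Matrix.mulVec] using h

variable {N : ℕ} (G : CommGraph N)

theorem CommGraph.a_nonneg (i j : Fin N) : 0 ≤ G.a i j := by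
  by_cases h : G.graph.Adj i j
  · exact (G.pos_of_adj i j h).le
  · exact (G.zero_of_not_adj i j h).ge

theorem CommGraph.laplacian_isHermitian : G.laplacian.IsHermitian :=
  (Matrix.isHermitian_diagonal _).sub (Matrix.IsHermitian.ext fun i j => G.symm j i)

/-- The stacked outputs of `N` agents with outputs in `W`, with the Euclidean norm. -/
abbrev Stack (N : ℕ) (W : Type*) : Type _ := PiLp 2 fun _ : Fin N => W

/-- The Laplacian acting on stacked outputs, i.e. `L ⊗ I`. -/
def CommGraph.laplacianOp (W : Type*) [NormedAddCommGroup W] [InnerProductSpace ℝ W] :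
    Stack N W →ₗ[ℝ] Stack N W where
  toFun z := WithLp.toLp 2 fun i => ∑ j, G.a i j • (z i - z j)
  map_add' x y := by
    ext i : 1
    simp only [PiLp.add_apply, add_sub_add_comm, smul_add, Finset.sum_add_distrib]
  map_smul' c x := by
    ext i : 1
    simp only [PiLp.smul_apply, RingHom.id_apply, Finset.smul_sum, ← smul_sub, smul_comm c]

theorem CommGraph.laplacianOp_apply (z : Stack N W) (i : Fin N) :
    G.laplacianOp W z i = ∑ j, G.a i j • (z i - z j) := rfl

theorem CommGraph.laplacianOp_apply_eq_sum_laplacian (z : Stack N W) (i : Fin N) :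
    G.laplacianOp W z i = ∑ j, G.laplacian i j • z j := by
  simp only [G.laplacianOp_apply, CommGraph.laplacian, Matrix.sub_apply, Matrix.diagonal_apply,
    smul_sub, sub_smul, ite_smul, zero_smul, Finset.sum_sub_distrib, Finset.sum_ite_eq,
    Finset.mem_univ, if_true, Finset.sum_smul, G.symm i]

theorem CommGraph.inner_laplacianOp (x y : Stack N W) :
    inner ℝ (G.laplacianOp W x) y
      = 1 / 2 * ∑ i, ∑ j, G.a i j * inner ℝ (x i - x j) (y i - y j) := by
  have hinner : inner ℝ (G.laplacianOp W x) y
      = ∑ i, ∑ j, G.a i j * inner ℝ (x i - x j) (y i) := by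
    simp only [PiLp.inner_apply, G.laplacianOp_apply, sum_inner, real_inner_smul_left]
  have hswap : ∑ i, ∑ j, G.a i j * inner ℝ (x i - x j) (y j)
      = -∑ i, ∑ j, G.a i j * inner ℝ (x i - x j) (y i) := by
    rw [Finset.sum_comm]
    simp only [← Finset.sum_neg_distrib, ← mul_neg, ← inner_neg_left, neg_sub, G.symm]
  simp only [inner_sub_right, mul_sub, Finset.sum_sub_distrib, hswap, hinner]
  ring

theorem CommGraph.laplacianOp_isPositive : (G.laplacianOp W).IsPositive := by
  refine (LinearMap.isPositive_iff _).2 ⟨fun x y => ?_, fun x => ?_⟩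
  · rw [real_inner_comm (G.laplacianOp W y), G.inner_laplacianOp, G.inner_laplacianOp]
    simp only [real_inner_comm]
  · rw [G.inner_laplacianOp]
    exact mul_nonneg (by norm_num) (Finset.sum_nonneg fun i _ => Finset.sum_nonneg fun j _ =>
      mul_nonneg (G.a_nonneg i j) real_inner_self_nonneg)

theorem CommGraph.inner_laplacianOp_self_le (x : Stack N W) :
    inner ℝ (G.laplacianOp W x) x ≤ G.lambdaMax * ‖x‖ ^ 2 := by
  have h := sum_mul_inner_nonneg (posSemidef_sSup_spectrum_sub G.laplacian_isHermitian) x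
  have hL : inner ℝ (G.laplacianOp W x) x
      = ∑ i, ∑ j, G.laplacian i j * inner ℝ (x i) (x j) := by
    rw [real_inner_comm]
    simp only [PiLp.inner_apply, G.laplacianOp_apply_eq_sum_laplacian, inner_sum,
      real_inner_smul_right]
  have hnorm : ‖x‖ ^ 2 = ∑ i, inner ℝ (x i) (x i) := by
    simp only [PiLp.norm_sq_eq_of_L2, real_inner_self_eq_norm_sq]
  simp only [Matrix.sub_apply, Matrix.algebraMap_matrix_apply, sub_mul, ite_mul, zero_mul,
    Finset.sum_sub_distrib, Finset.sum_ite_eq, Finset.mem_univ, if_true] at h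
  rw [hL, hnorm, Finset.mul_sum]
  exact sub_nonneg.1 h

theorem CommGraph.eq_of_mem_ker_laplacianOp (hG : G.graph.Connected) {x : Stack N W}
    (hx : x ∈ LinearMap.ker (G.laplacianOp W)) (i j : Fin N) : x i = x j := by
  have hnn : ∀ i j, 0 ≤ G.a i j * inner ℝ (x i - x j) (x i - x j) := fun i j =>
    mul_nonneg (G.a_nonneg i j) real_inner_self_nonneg
  have hsum : ∑ i, ∑ j, G.a i j * inner ℝ (x i - x j) (x i - x j) = 0 := by
    have h := G.inner_laplacianOp x x
    rw [LinearMap.mem_ker.1 hx, inner_zero_left] at h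
    linarith
  have hadj : ∀ i j, G.graph.Adj i j → x i = x j := by
    intro i j hij
    have hi := (Fintype.sum_eq_zero_iff_of_nonneg fun i => Finset.sum_nonneg fun j _ => hnn i j).1
      hsum
    have hij0 := congrFun ((Fintype.sum_eq_zero_iff_of_nonneg (hnn i)).1 (congrFun hi i)) j
    exact sub_eq_zero.1 (inner_self_eq_zero.1
      ((mul_eq_zero.1 hij0).resolve_left (G.pos_of_adj i j hij).ne'))
  obtain ⟨p⟩ := hG.preconnected i j
  induction p with
  | nil => rfl
  | cons h _ ih => exact (hadj _ _ h).trans ih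

end Laplacian

section StrongMonotonicity

variable {W : Type*} [NormedAddCommGroup W] [InnerProductSpace ℝ W]

/-- `g` is strongly monotone with constant `m`; for a gradient this is `m`-strong convexity of the
underlying function. -/
def IsStronglyMonotone (m : ℝ) (g : W → W) : Prop :=
  ∀ x y, m * ‖x - y‖ ^ 2 ≤ inner ℝ (x - y) (g x - g y)

theorem IsStronglyMonotone.mono {m m' : ℝ} {g : W → W} (hg : IsStronglyMonotone m g)
    (hm : m' ≤ m) : IsStronglyMonotone m' g := fun x y =>
  (mul_le_mul_of_nonneg_right hm (sq_nonneg _)).trans (hg x y)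

theorem IsStronglyMonotone.sum {ι : Type*} {s : Finset ι} {m : ι → ℝ} {g : ι → W → W}
    (hg : ∀ i, IsStronglyMonotone (m i) (g i)) :
    IsStronglyMonotone (∑ i ∈ s, m i) fun x => ∑ i ∈ s, g i x := by
  intro x y
  rw [← Finset.sum_sub_distrib, inner_sum, Finset.sum_mul]
  exact Finset.sum_le_sum fun i _ => hg i x y

variable {F : W → ℝ} {g : W → W} {m : ℝ}

theorem IsStronglyMonotone.add_inner_add_sq_le [CompleteSpace W] (hg : IsStronglyMonotone m g)
    (hF : ∀ x, HasGradientAt F (g x) x) (x y : W) :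
    F x + inner ℝ (g x) (y - x) + m / 2 * ‖y - x‖ ^ 2 ≤ F y := by
  set d := y - x with hd
  let φ (t : ℝ) : ℝ := F (x + t • d) - t * inner ℝ (g x) d - m / 2 * ‖d‖ ^ 2 * t ^ 2
  have hφ (t : ℝ) :
      HasDerivAt φ (inner ℝ (g (x + t • d) - g x) d - m * ‖d‖ ^ 2 * t) t := by
    have hline : HasDerivAt (fun t : ℝ => x + t • d) d t := by
      simpa using ((hasDerivAt_id t).smul_const d).const_add x
    refine ((((hF (x + t • d)).hasFDerivAt.comp_hasDerivAt t hline).sub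
      ((hasDerivAt_id t).mul_const (inner ℝ (g x) d))).sub
      ((hasDerivAt_pow 2 t).const_mul (m / 2 * ‖d‖ ^ 2))).congr_deriv ?_
    rw [InnerProductSpace.toDual_apply_apply, inner_sub_left]
    ring
  have hmono : MonotoneOn φ (Icc 0 1) := by
    refine monotoneOn_of_hasDerivWithinAt_nonneg (convex_Icc 0 1)
      (fun t _ => (hφ t).continuousAt.continuousWithinAt) (fun t _ => (hφ t).hasDerivWithinAt)
      fun t ht => sub_nonneg.2 ?_
    rw [interior_Icc] at ht
    refine le_of_mul_le_mul_left ?_ ht.1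
    calc t * (m * ‖d‖ ^ 2 * t) = m * ‖x + t • d - x‖ ^ 2 := by
          rw [add_sub_cancel_left, norm_smul, mul_pow, Real.norm_eq_abs, sq_abs]
          ring
      _ ≤ inner ℝ (x + t • d - x) (g (x + t • d) - g x) := hg _ _
      _ = t * inner ℝ (g (x + t • d) - g x) d := by
          rw [add_sub_cancel_left, real_inner_smul_left, real_inner_comm]
  have h01 := hmono (left_mem_Icc.2 zero_le_one) (right_mem_Icc.2 zero_le_one) zero_le_one
  simp only [φ, hd, zero_smul, one_smul, add_zero, add_sub_cancel, zero_mul, one_mul, sub_zero,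
    one_pow, mul_one, zero_pow two_ne_zero, mul_zero] at h01
  linarith

theorem IsStronglyMonotone.lt_of_eq_zero [CompleteSpace W] (hm : 0 < m)
    (hg : IsStronglyMonotone m g) (hF : ∀ x, HasGradientAt F (g x) x) {x y : W} (hx : g x = 0)
    (hxy : y ≠ x) : F x < F y := by
  have hpos : 0 < m / 2 * ‖y - x‖ ^ 2 :=
    mul_pos (half_pos hm) (pow_pos (norm_pos_iff.2 (sub_ne_zero.2 hxy)) 2)
  have h := hg.add_inner_add_sq_le hF x y
  rw [hx, inner_zero_left] at h
  linarith

theorem IsStronglyMonotone.exists_eq_zero [FiniteDimensional ℝ W] (hm : 0 < m)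
    (hg : IsStronglyMonotone m g) (hF : ∀ x, HasGradientAt F (g x) x) : ∃ x, g x = 0 := by
  have hcoercive : ∀ᶠ x in cocompact W, F 0 ≤ F x := by
    filter_upwards [tendsto_norm_cocompact_atTop.eventually_ge_atTop (2 * ‖g 0‖ / m)] with x hx
    rw [div_le_iff₀' hm] at hx
    have hlower := hg.add_inner_add_sq_le hF 0 x
    rw [sub_zero] at hlower
    linarith [neg_le_of_abs_le (abs_real_inner_le_norm (g 0) x),
      mul_le_mul_of_nonneg_right hx (norm_nonneg x)]
  obtain ⟨x, hx⟩ := (continuous_iff_continuousAt.2 fun x => (hF x).continuousAt).exists_forall_le'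
    0 hcoercive
  have hmin : IsLocalMin F x := Eventually.of_forall hx
  exact ⟨x, (map_eq_zero_iff _ (InnerProductSpace.toDual ℝ W).injective).1
    (hmin.hasFDerivAt_eq_zero (hF x).hasFDerivAt)⟩

end StrongMonotonicity

section Optimum

variable {N q : ℕ} [Nonempty (Fin N)] {S : MultiAgent N q} {m : Fin N → ℝ}

theorem MultiAgent.isOptimal_iff {z : EuclideanSpace ℝ (Fin q)} :
    S.IsOptimal z ↔ ∀ v, ∑ i, S.f i z ≤ ∑ i, S.f i v := by
  refine ⟨fun h v => h (a := fun _ => v) fun _ _ => rfl, fun h y hy => ?_⟩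
  obtain ⟨i₀⟩ := ‹Nonempty (Fin N)›
  have hconst : y = fun _ => y i₀ := funext fun i => hy i i₀
  rw [hconst]
  exact h (y i₀)

theorem MultiAgent.StronglyConvexCosts.exists_isOptimal (hm : S.StronglyConvexCosts m)
    (hf : ∀ i, Differentiable ℝ (S.f i)) :
    ∃ ystar, S.IsOptimal ystar ∧ (∀ z, S.IsOptimal z → z = ystar) ∧
      ∑ i, gradient (S.f i) ystar = 0 := by
  have hpos : 0 < ∑ i, m i := Finset.sum_pos (fun i _ => hm.pos i) Finset.univ_nonempty
  have hmono : IsStronglyMonotone (∑ i, m i) fun x => ∑ i, gradient (S.f i) x :=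
    IsStronglyMonotone.sum hm.strong
  have hF (x) : HasGradientAt (fun v => ∑ i, S.f i v) (∑ i, gradient (S.f i) x) x := by
    rw [hasGradientAt_iff_hasFDerivAt, map_sum]
    exact HasFDerivAt.fun_sum fun i _ => (hf i x).hasGradientAt.hasFDerivAt
  obtain ⟨ystar, hzero⟩ := hmono.exists_eq_zero hpos hF
  have hlt {z} (hz : z ≠ ystar) : ∑ i, S.f i ystar < ∑ i, S.f i z :=
    hmono.lt_of_eq_zero hpos hF hzero hz
  refine ⟨ystar, MultiAgent.isOptimal_iff.2 fun v => ?_, fun z hz => ?_, hzero⟩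
  · rcases eq_or_ne v ystar with rfl | hv
    exacts [le_rfl, (hlt hv).le]
  · by_contra hne
    exact (hlt hne).not_ge (MultiAgent.isOptimal_iff.1 hz ystar)

end Optimum

section StackedErrors

variable {N : ℕ} {W : Type*} [NormedAddCommGroup W]

/-- The stack of the increments `g i (v + z i) - g i v`: the local maps `g i` acting on the errors
`z i` relative to the consensus value `v`. -/
def stackShift (g : Fin N → W → W) (v : W) (z : Stack N W) : Stack N W :=
  WithLp.toLp 2 fun i => g i (v + z i) - g i v

theorem continuous_stackShift {g : Fin N → W → W} (hg : ∀ i, Continuous (g i)) (v : W) :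
    Continuous (stackShift g v) :=
  (PiLp.continuous_toLp 2 _).comp <| continuous_pi fun i =>
    ((hg i).comp (by fun_prop)).sub continuous_const

theorem norm_stackShift_le {g : Fin N → W → W} {w : ℝ} (hw : 0 ≤ w)
    (hg : ∀ i x y, ‖g i x - g i y‖ ≤ w * ‖x - y‖) (v : W) (z : Stack N W) :
    ‖stackShift g v z‖ ≤ w * ‖z‖ := by
  refine (pow_le_pow_iff_left₀ (norm_nonneg _) (by positivity) two_ne_zero).1 ?_
  rw [mul_pow, PiLp.norm_sq_eq_of_L2, PiLp.norm_sq_eq_of_L2, Finset.mul_sum]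
  refine Finset.sum_le_sum fun i _ => ?_
  rw [← mul_pow]
  refine pow_le_pow_left₀ (norm_nonneg _) ?_ 2
  simpa [stackShift] using hg i (v + z i) v

theorem continuousOn_stack {f : Fin N → ℝ → W} {s : Set ℝ} (hf : ∀ i, ContinuousOn (f i) s) :
    ContinuousOn (fun r => (WithLp.toLp 2 fun i => f i r : Stack N W)) s :=
  (PiLp.continuous_toLp 2 _).comp_continuousOn (continuousOn_pi.2 hf)

variable [InnerProductSpace ℝ W]

theorem le_inner_stackShift {g : Fin N → W → W} {m : ℝ} (hg : ∀ i, IsStronglyMonotone m (g i))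
    (v : W) (z : Stack N W) : m * ‖z‖ ^ 2 ≤ inner ℝ z (stackShift g v z) := by
  rw [PiLp.norm_sq_eq_of_L2, PiLp.inner_apply, Finset.mul_sum]
  refine Finset.sum_le_sum fun i _ => ?_
  simpa [stackShift] using hg i (v + z i) v

theorem hasDerivWithinAt_stack {f : Fin N → ℝ → W} {f' : Stack N W} {s : Set ℝ} {t : ℝ}
    (hf : ∀ i, HasDerivWithinAt (f i) (f' i) s t) :
    HasDerivWithinAt (fun r => (WithLp.toLp 2 fun i => f i r : Stack N W)) f' s t := by
  have hpi : HasDerivWithinAt (fun r i => f i r) (fun i => f' i) s t := hasDerivWithinAt_pi.2 hf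
  exact ((PiLp.continuousLinearEquiv 2 ℝ fun _ : Fin N => W).symm :
    _ →L[ℝ] Stack N W).hasFDerivAt.comp_hasDerivWithinAt t hpi

theorem mem_orthogonal_ker_laplacianOp {G : CommGraph N} (hG : G.graph.Connected)
    {x : Stack N W} (hx : ∑ i, x i = 0) : x ∈ (LinearMap.ker (G.laplacianOp W))ᗮ := by
  intro c hc
  obtain ⟨i₀⟩ := hG.nonempty
  simp_rw [PiLp.inner_apply, G.eq_of_mem_ker_laplacianOp hG hc _ i₀]
  rw [← inner_sum, hx, inner_zero_right]

theorem isSampledSolution_stack {G : CommGraph N} (hG : G.graph.Connected) {g : Fin N → W → W}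
    {v : W} (hv : ∑ i, g i v = 0) {T : ℕ → ℝ} {y yhat η : Fin N → ℝ → W}
    (hhold : ∀ i k, ∀ t ∈ Ico (T k) (T (k + 1)), yhat i t = y i (T k))
    (hyc : ∀ i, ContinuousOn (y i) (Ici 0)) (hηc : ∀ i, ContinuousOn (η i) (Ici 0))
    (hη0 : ∀ i, η i 0 = 0)
    (hy : ∀ i t, 0 ≤ t → HasDerivWithinAt (y i)
      (-g i (y i t) - ∑ j, G.a i j • (yhat i t - yhat j t) - η i t) (Ici t) t)
    (hη : ∀ i t, 0 ≤ t → HasDerivWithinAt (η i)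
      (∑ j, G.a i j • (yhat i t - yhat j t)) (Ici t) t) :
    IsSampledSolution (G.laplacianOp W) (stackShift g v) T
      (fun t => WithLp.toLp 2 fun i => y i t - v) (fun t => WithLp.toLp 2 fun i => yhat i t - v)
      (fun t => WithLp.toLp 2 fun i => η i t + g i v) := by
  have hlap (t : ℝ) (i : Fin N) : ∑ j, G.a i j • (yhat i t - yhat j t)
      = G.laplacianOp W (WithLp.toLp 2 fun i => yhat i t - v) i := by
    simp only [G.laplacianOp_apply, sub_sub_sub_cancel_right]
  have hζc := continuousOn_stack fun i => (hηc i).add (continuousOn_const (c := g i v))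
  have hζd (t : ℝ) (ht : 0 ≤ t) := hasDerivWithinAt_stack
    (f' := G.laplacianOp W (WithLp.toLp 2 fun i => yhat i t - v))
    fun i => hlap t i ▸ (hη i t ht).add_const (g i v)
  refine ⟨continuousOn_stack fun i => (hyc i).sub continuousOn_const, hζc, fun k t ht => ?_,
    fun t ht => hasDerivWithinAt_stack fun i => ?_, hζd, fun t ht =>
    mem_orthogonal_ker_of_hasDerivWithinAt_Ici G.laplacianOp_isPositive.isSymmetric hζc
      (mem_orthogonal_ker_laplacianOp hG ?_) hζd ht⟩
  · simp only [hhold _ k t ht]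
  · refine ((hy i t ht).sub_const v).congr_deriv ?_
    simp only [hlap, PiLp.sub_apply, PiLp.neg_apply, stackShift, add_sub_cancel]
    abel
  · simpa [hη0] using hv

end StackedErrors

section ClosedLoop

variable {N q : ℕ} {S : MultiAgent N q} {G : CommGraph N} {w m : Fin N → ℝ}

theorem MultiAgent.SmoothCosts.lipschitz_iSup (hw : S.SmoothCosts w) (i : Fin N)
    (x y : EuclideanSpace ℝ (Fin q)) :
    ‖gradient (S.f i) x - gradient (S.f i) y‖ ≤ (⨆ i, w i) * ‖x - y‖ :=
  (hw.lipschitz i x y).trans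
    (mul_le_mul_of_nonneg_right (le_ciSup (finite_range w).bddAbove i) (norm_nonneg _))

theorem MultiAgent.SmoothCosts.continuous_gradient (hw : S.SmoothCosts w) (i : Fin N) :
    Continuous (gradient (S.f i)) :=
  (LipschitzWith.of_dist_le' fun x y => by
    simpa only [dist_eq_norm] using hw.lipschitz i x y).continuous

theorem MultiAgent.StronglyConvexCosts.iInf_pos [Nonempty (Fin N)]
    (hm : S.StronglyConvexCosts m) : 0 < ⨅ i, m i := by
  obtain ⟨i, hi⟩ := exists_eq_ciInf_of_finite (f := m)
  exact hi ▸ hm.pos i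

theorem MultiAgent.StronglyConvexCosts.isStronglyMonotone_iInf (hm : S.StronglyConvexCosts m)
    (i : Fin N) : IsStronglyMonotone (⨅ i, m i) (gradient (S.f i)) :=
  IsStronglyMonotone.mono (hm.strong i) (ciInf_le (finite_range m).bddBelow i)

variable {Kα : ∀ i, Matrix (Fin (S.p i)) (Fin (S.n i)) ℝ}
  {Kβ : ∀ i, Matrix (Fin (S.p i)) (Fin q) ℝ} {tk : Fin N → ℕ → ℝ}
  {x : ∀ i, ℝ → EuclideanSpace ℝ (Fin (S.n i))} {u : ∀ i, ℝ → EuclideanSpace ℝ (Fin (S.p i))}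
  {y yhat η : Fin N → ℝ → EuclideanSpace ℝ (Fin q)}

theorem MultiAgent.IsTrajectory.hasDerivWithinAt_output
    (h : S.IsTrajectory G Kα Kβ tk x u y yhat η)
    (hKα : ∀ i, S.C i * S.B i * Kα i = S.C i * S.A i)
    (hKβ : ∀ i, S.C i * S.B i * Kβ i = 1) (i : Fin N) (t : ℝ) (ht : 0 ≤ t) :
    HasDerivWithinAt (y i)
      (-gradient (S.f i) (y i t) - ∑ j, G.a i j • (yhat i t - yhat j t) - η i t) (Ici t) t := by
  have hCx : HasDerivWithinAt (fun s => Matrix.toEuclideanLin (S.C i) (x i s))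
      (Matrix.toEuclideanLin (S.C i) (Matrix.toEuclideanLin (S.A i) (x i t)
        + Matrix.toEuclideanLin (S.B i) (u i t))) (Ici t) t :=
    (Matrix.toEuclideanLin (S.C i)).toContinuousLinearMap.hasFDerivAt.comp_hasDerivWithinAt t
      (h.state_deriv i t ht)
  refine (hCx.congr (fun s hs => h.output i s (ht.trans hs)) (h.output i t ht)).congr_deriv ?_
  rw [h.input i t ht]
  generalize -gradient (S.f i) (y i t) - ∑ j, G.a i j • (yhat i t - yhat j t) - η i t = r
  simp only [map_add, map_neg, ← LinearMap.comp_apply, ← Matrix.toLpLin_mul_same,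
    ← Matrix.mul_assoc, hKα i, hKβ i, Matrix.toLpLin_one, LinearMap.id_apply,
    add_neg_cancel_left]

theorem MultiAgent.IsTrajectory.continuousOn_output
    (h : S.IsTrajectory G Kα Kβ tk x u y yhat η) (i : Fin N) : ContinuousOn (y i) (Ici 0) :=
  ((Matrix.toEuclideanLin (S.C i)).continuous_of_finiteDimensional.comp_continuousOn
    (h.state_continuous i)).congr fun t ht => h.output i t ht

theorem MultiAgent.IsTrajectory.isSampledSolution {T : ℕ → ℝ} (hG : G.graph.Connected)
    (hKα : ∀ i, S.C i * S.B i * Kα i = S.C i * S.A i) (hKβ : ∀ i, S.C i * S.B i * Kβ i = 1)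
    {ystar : EuclideanSpace ℝ (Fin q)} (hystar : ∑ i, gradient (S.f i) ystar = 0)
    (h : S.IsTrajectory G Kα Kβ (fun _ => T) x u y yhat η) :
    IsSampledSolution (G.laplacianOp _) (stackShift (fun i => gradient (S.f i)) ystar) T
      (fun t => WithLp.toLp 2 fun i => y i t - ystar)
      (fun t => WithLp.toLp 2 fun i => yhat i t - ystar)
      (fun t => WithLp.toLp 2 fun i => η i t + gradient (S.f i) ystar) :=
  isSampledSolution_stack hG hystar h.hold h.continuousOn_output h.integral_continuous
    h.integral_zero (h.hasDerivWithinAt_output hKα hKβ) h.integral_deriv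

end ClosedLoop

end OptimalOutput

theorem theorem2_general {N q : ℕ} (S : OptimalOutput.MultiAgent N q)
    (G : OptimalOutput.CommGraph N) (w m : Fin N → ℝ) (hG : G.graph.Connected)
    (hw : S.SmoothCosts w) (hm : S.StronglyConvexCosts m)
    (Kα : ∀ i, Matrix (Fin (S.p i)) (Fin (S.n i)) ℝ) (Kβ : ∀ i, Matrix (Fin (S.p i)) (Fin q) ℝ)
    (hKα : ∀ i, S.C i * S.B i * Kα i = S.C i * S.A i) (hKβ : ∀ i, S.C i * S.B i * Kβ i = 1)
    (ξ : ℝ) (hξ : (4 * (⨆ i, w i) ^ 2 + 2 * G.lambdaMax ^ 2 + 1) / (8 * ⨅ i, m i) < ξ) :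
    ∃ ystar : EuclideanSpace ℝ (Fin q),
      S.IsOptimal ystar ∧ (∀ z, S.IsOptimal z → z = ystar) ∧
      ∃ c : ℝ, 0 < c ∧
        ∀ T, OptimalOutput.IsSamplingSequence
          (OptimalOutput.tau0 (⨆ i, w i) G.lambdaMax ξ) T →
        ∀ x u y yhat η, S.IsTrajectory G Kα Kβ (fun _ => T) x u y yhat η →
          ∃ M : ℝ, ∀ i, ∀ t, 0 ≤ t → ‖y i t - ystar‖ ≤ M * Real.exp (-c * t) := by
  have : Nonempty (Fin N) := hG.nonempty
  obtain ⟨ystar, hopt, huniq, hgrad⟩ := hm.exists_isOptimal hw.differentiable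
  have hm0 : 0 < ⨅ i, m i := hm.iInf_pos
  have hw0 : 0 ≤ ⨆ i, w i := Real.iSup_nonneg fun i => (hw.pos i).le
  rw [div_lt_iff₀' (by positivity)] at hξ
  obtain ⟨c, hc, hdecay⟩ := OptimalOutput.exists_norm_le_mul_exp_of_isSampledSolution
    G.laplacianOp_isPositive G.inner_laplacianOp_self_le hm0 hξ
    (OptimalOutput.continuous_stackShift hw.continuous_gradient ystar)
    (OptimalOutput.le_inner_stackShift hm.isStronglyMonotone_iInf ystar)
    (OptimalOutput.norm_stackShift_le hw0 hw.lipschitz_iSup ystar)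
  refine ⟨ystar, hopt, huniq, c, hc, fun T hT x u y yhat η htraj => ?_⟩
  obtain ⟨M, hM⟩ := hdecay T hT _ _ _ (htraj.isSampledSolution hG hKα hKβ hgrad)
  exact ⟨M, fun i t ht => (PiLp.norm_apply_le (WithLp.toLp 2 fun i => y i t - ystar) i).trans
    (hM t ht)⟩

theorem theorem2 {N q : ℕ} (S : OptimalOutput.MultiAgent N q) (G : OptimalOutput.CommGraph N)
    (w m : Fin N → ℝ)
    (hG : G.graph.Connected)
    (hw : S.SmoothCosts w)
    (hm : S.StronglyConvexCosts m)
    (hrank : S.RankCondition)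
    (Kα : ∀ i, Matrix (Fin (S.p i)) (Fin (S.n i)) ℝ)
    (Kβ : ∀ i, Matrix (Fin (S.p i)) (Fin q) ℝ)
    (hKα : ∀ i, S.C i * S.B i * Kα i = S.C i * S.A i)
    (hKβ : ∀ i, S.C i * S.B i * Kβ i = 1)
    (ξ : ℝ)
    (hξ : (4 * (⨆ i, w i) ^ 2 + 2 * G.lambdaMax ^ 2 + 1) / (8 * ⨅ i, m i) < ξ) :
    ∃ ystar : EuclideanSpace ℝ (Fin q),
      S.IsOptimal ystar ∧ (∀ z, S.IsOptimal z → z = ystar) ∧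
      ∃ c : ℝ, 0 < c ∧
        ∀ Δ ∈ Set.Ioc 0 (OptimalOutput.tau0 (⨆ i, w i) G.lambdaMax ξ),
        ∀ tk : Fin N → ℕ → ℝ, (∀ i, tk i 0 = 0) → (∀ i k, tk i (k + 1) = tk i k + Δ) →
        ∀ x u y yhat η, S.IsTrajectory G Kα Kβ tk x u y yhat η →
          ∃ M : ℝ, ∀ i, ∀ t, 0 ≤ t → ‖y i t - ystar‖ ≤ M * Real.exp (-c * t) := by
  obtain ⟨ystar, hopt, huniq, c, hc, hdecay⟩ :=
    theorem2_general S G w m hG hw hm Kα Kβ hKα hKβ ξ hξ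
  refine ⟨ystar, hopt, huniq, c, hc, fun Δ hΔ tk h0 hs x u y yhat η htraj => ?_⟩
  obtain rfl : tk = fun _ (k : ℕ) => k * Δ :=
    funext fun i => OptimalOutput.eq_natCast_mul_of_add (h0 i) (hs i)
  exact hdecay _ (OptimalOutput.isSamplingSequence_natCast_mul hΔ) x u y yhat η htraj
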